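/- An overpartition of a nonnegative integer $n$ is a partition of $n$ in which the first occurrence of each distinct part size may be overlined. Let $\mathrm{nov}(n)$ (respectively $\mathrm{ov}(n)$) denote the sum, over all overpartitions of $n$, of the non-overlined (respectively overlined) parts. Then for every integer $n \ge 0$, $$(n+2)\,\mathrm{nov}(n) \equiv (n^2+4n+3)\,\mathrm{ov}(n) \pmod 5$$ and $$(n^2+1)\,\mathrm{nov}(n) \equiv (4n^3-n^2-1)\,\mathrm{ov}(n) \pmod 7.$$ -/

import Mathlib

/-- An overpartition of `n`: a partition of `n` in which the first occurrence of each distinct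
part size may be overlined. It is given by the underlying partition and the set of those part
sizes whose first occurrence is overlined. -/
@[ext]
structure Overpartition (n : ℕ) where
  /-- the underlying partition, with the overlines forgotten -/
  partition : n.Partition
  /-- the sizes whose first occurrence is overlined -/
  marked : Finset ℕ
  /-- only sizes that occur in the partition can be overlined -/
  marked_subset : marked ⊆ partition.parts.toFinset

namespace Overpartition

/-- An overpartition is the same as a partition together with a subset of its part sizes. -/
def equivSigma (n : ℕ) :
    (Σ p : n.Partition, {s : Finset ℕ // s ∈ p.parts.toFinset.powerset}) ≃ Overpartition n where
  toFun x := ⟨x.1, x.2.1, Finset.mem_powerset.mp x.2.2⟩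
  invFun o := ⟨o.partition, o.marked, Finset.mem_powerset.mpr o.marked_subset⟩
  left_inv _ := rfl
  right_inv _ := rfl

instance (n : ℕ) : Fintype (Overpartition n) := Fintype.ofEquiv _ (equivSigma n)

/-- The multiset of overlined parts: each overlined size occurs exactly once as overlined part. -/
def overlinedParts {n : ℕ} (o : Overpartition n) : Multiset ℕ := o.marked.val

/-- The multiset of non-overlined parts: all parts, with one occurrence of each overlined size
removed. -/
def nonOverlinedParts {n : ℕ} (o : Overpartition n) : Multiset ℕ :=
  o.partition.parts - o.marked.val

end Overpartition

/-- `ov n` is the sum, over all overpartitions of `n`, of the overlined parts. -/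
def ov (n : ℕ) : ℕ := ∑ o : Overpartition n, o.overlinedParts.sum

/-- `nov n` is the sum, over all overpartitions of `n`, of the non-overlined parts. -/
def nov (n : ℕ) : ℕ := ∑ o : Overpartition n, o.nonOverlinedParts.sum

/-!
Let `P` be the generating function of overpartitions and `D = X d/dX`. Separating overlined from
non-overlined parts gives `∑ (nov n + ov n) Xⁿ = D P`, while `24 ∑ ov n Xⁿ = P (E - 1)` for the
Eisenstein series `E = 1 + 24 ∑ k Xᵏ / (1 + Xᵏ)`. By Gauss, `P = 1 / θ₄`. With `w = D θ₄ / θ₄` and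
`U = θ₂⁴ θ₃⁴`, and with `E = θ₂⁴ + θ₃⁴`, one has the differential system
`8 D w = 16 w² - U`, `D E = 4 w E + 2 U`, `D U = U (8 w + E)`. These identities need no complex
analysis: by the duplication formulas for `θ₃` and `θ₄`, the difference of the two sides satisfies a
functional equation relating it to its own image under `X ↦ X²`, which only `0` solves.

Modulo an odd prime `p`, the exponents in `θ₄ = ∑ (-1)ʲ X^(j²)` being squares gives
`D^((p + 1) / 2) θ₄ = D θ₄`. By the differential system this expresses `w` through `E` and `U`
for `p = 5` and `p = 7`, and then `D² (P E) = -2 D P` modulo `5` and `D³ (P E) = -D P` modulo `7`.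
The congruences are the coefficients of these two identities.
-/

open PowerSeries Finset

section EulerOperator

variable {R : Type*} [CommRing R]

lemma coeff_ofNat_mul (n m : ℕ) [m.AtLeastTwo] (f : R⟦X⟧) :
    coeff n (ofNat(m) * f) = ofNat(m) * coeff n f := by
  rw [← map_ofNat (C (R := R)), coeff_C_mul]

/-- The Euler operator `X · d/dX` on power series. -/
noncomputable def euler (R : Type*) [CommRing R] : Derivation R R⟦X⟧ R⟦X⟧ :=
  (X : R⟦X⟧) • PowerSeries.derivative R

lemma coeff_euler (f : R⟦X⟧) (n : ℕ) : coeff n (euler R f) = n * coeff n f := by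
  rw [euler, Derivation.smul_apply, smul_eq_mul]
  cases n with
  | zero => simp
  | succ n => rw [mul_comm, coeff_succ_mul_X, coeff_derivative, Nat.cast_succ, mul_comm]

lemma coeff_iterate_euler (f : R⟦X⟧) (m n : ℕ) :
    coeff n ((euler R)^[m] f) = (n : R) ^ m * coeff n f := by
  induction m with
  | zero => simp
  | succ m ih => rw [Function.iterate_succ_apply', coeff_euler, ih, pow_succ', mul_assoc]

lemma constantCoeff_euler (f : R⟦X⟧) : constantCoeff (euler R f) = 0 := by
  rw [← coeff_zero_eq_constantCoeff_apply, coeff_euler, Nat.cast_zero, zero_mul]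

lemma euler_ofNat_mul (n : ℕ) [n.AtLeastTwo] (f : R⟦X⟧) :
    euler R (ofNat(n) * f) = ofNat(n) * euler R f := by
  rw [← Nat.cast_ofNat, ← nsmul_eq_mul, map_nsmul, nsmul_eq_mul]

lemma euler_expand {p : ℕ} (hp : p ≠ 0) (f : R⟦X⟧) :
    euler R (expand p hp f) = p * expand p hp (euler R f) := by
  ext n
  rw [← nsmul_eq_mul, map_nsmul, coeff_euler]
  by_cases h : p ∣ n
  · obtain ⟨k, rfl⟩ := h
    rw [coeff_expand_mul, coeff_expand_mul, coeff_euler, nsmul_eq_mul, Nat.cast_mul, mul_assoc]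
  · rw [coeff_expand_of_not_dvd _ _ _ h, coeff_expand_of_not_dvd _ _ _ h, mul_zero, smul_zero]

lemma eq_zero_of_eq_C_mul_expand {p : ℕ} (hp : 1 < p) {c : R} {f : R⟦X⟧}
    (h0 : constantCoeff f = 0) (hf : f = C c * expand p (Nat.ne_zero_of_lt hp) f) : f = 0 := by
  ext n
  induction n using Nat.strong_induction_on with
  | _ n ih =>
    rcases n.eq_zero_or_pos with rfl | hn
    · simpa using h0
    rw [hf, coeff_C_mul, map_zero]
    by_cases h : p ∣ n
    · obtain ⟨k, rfl⟩ := h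
      have hk : k < p * k := lt_mul_of_one_lt_left (Nat.pos_of_mul_pos_left hn) hp
      rw [coeff_expand_mul, ih k hk, map_zero, mul_zero]
    · rw [coeff_expand_of_not_dvd _ _ _ h, mul_zero]

lemma eq_zero_of_mul_expand_two_eq_mul [IsDomain R] {a b f : R⟦X⟧} (hb : coeff 1 b ≠ 0)
    (h0 : coeff 0 f = 0) (h1 : coeff 1 f = 0) (hf : a * expand 2 two_ne_zero f = b * f) :
    f = 0 := by
  by_contra hne
  have horder : a.order + 2 * f.order = b.order + f.order := by
    simpa only [order_mul, order_expand, nsmul_eq_mul, Nat.cast_ofNat] using congrArg order hf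
  have hle : f.order + f.order ≤ 1 + f.order :=
    calc f.order + f.order ≤ a.order + 2 * f.order := by rw [two_mul]; exact le_add_self
      _ = b.order + f.order := horder
      _ ≤ 1 + f.order := by gcongr; exact order_le 1 hb
  have hle1 : f.order ≤ 1 :=
    (ENat.add_le_add_iff_right (order_eq_top.not.mpr hne)).mp hle
  have hle2 : 2 ≤ f.order := nat_le_order f 2 fun i hi => by interval_cases i <;> assumption
  exact absurd (hle2.trans hle1) (by decide)

end EulerOperator

namespace Overpartition

/-- The overpartition whose overlined parts are the sizes of the parts of `d` and whose
non-overlined parts are the parts of `p`. Repeated parts of `d` are overlined only once. -/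
def ofParts {a b : ℕ} (d : a.Partition) (p : b.Partition) : Overpartition (a + b) where
  partition :=
    { parts := d.parts + p.parts
      parts_pos := fun h => (Multiset.mem_add.mp h).elim d.parts_pos p.parts_pos
      parts_sum := by rw [Multiset.sum_add, d.parts_sum, p.parts_sum] }
  marked := d.parts.toFinset
  marked_subset := fun _ h => by
    rw [Multiset.mem_toFinset] at h ⊢
    exact Multiset.mem_add.mpr (Or.inl h)

variable {a b n : ℕ}

lemma marked_val_le (o : Overpartition n) : o.marked.val ≤ o.partition.parts :=
  (Multiset.le_iff_subset o.marked.nodup).mpr fun _ h =>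
    Multiset.mem_toFinset.mp (o.marked_subset h)

lemma overlinedParts_add_nonOverlinedParts (o : Overpartition n) :
    o.overlinedParts + o.nonOverlinedParts = o.partition.parts :=
  add_tsub_cancel_of_le o.marked_val_le

lemma sum_overlinedParts_add_sum_nonOverlinedParts (o : Overpartition n) :
    o.overlinedParts.sum + o.nonOverlinedParts.sum = n := by
  rw [← Multiset.sum_add, overlinedParts_add_nonOverlinedParts, o.partition.parts_sum]

lemma overlinedParts_ofParts {d : a.Partition} (hd : d ∈ Nat.Partition.distincts a)
    (p : b.Partition) : (ofParts d p).overlinedParts = d.parts := by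
  rw [overlinedParts, ofParts, Multiset.toFinset_val]
  exact (Finset.mem_filter.mp hd).2.dedup

lemma nonOverlinedParts_ofParts {d : a.Partition} (hd : d ∈ Nat.Partition.distincts a)
    (p : b.Partition) : (ofParts d p).nonOverlinedParts = p.parts := by
  have h := overlinedParts_add_nonOverlinedParts (ofParts d p)
  rw [overlinedParts_ofParts hd] at h
  exact add_left_cancel h

lemma exists_ofParts_eq (o : Overpartition (a + b)) (ha : o.overlinedParts.sum = a) :
    ∃ d ∈ Nat.Partition.distincts a, ∃ p : b.Partition, ofParts d p = o := by
  have hb : o.nonOverlinedParts.sum = b := by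
    have := o.sum_overlinedParts_add_sum_nonOverlinedParts
    omega
  have hparts := o.overlinedParts_add_nonOverlinedParts
  refine ⟨⟨o.overlinedParts, fun h => o.partition.parts_pos ?_, ha⟩,
    Finset.mem_filter.mpr ⟨mem_univ _, o.marked.nodup⟩,
    ⟨o.nonOverlinedParts, fun h => o.partition.parts_pos ?_, hb⟩, ?_⟩
  · exact hparts ▸ Multiset.mem_add.mpr (Or.inl h)
  · exact hparts ▸ Multiset.mem_add.mpr (Or.inr h)
  · ext1
    · exact Nat.Partition.ext hparts
    · exact o.marked.val_toFinset

lemma card_filter_sum_overlinedParts (a b : ℕ) :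
    #{o : Overpartition (a + b) | o.overlinedParts.sum = a} =
      #(Nat.Partition.distincts a) * Fintype.card b.Partition := by
  rw [← card_univ, ← card_product]
  symm
  refine card_bij (fun x _ => ofParts x.1 x.2) ?_ ?_ ?_
  · rintro ⟨d, p⟩ h
    have hd := (mem_product.mp h).1
    rw [mem_filter_univ, overlinedParts_ofParts hd, d.parts_sum]
  · rintro ⟨d, p⟩ h ⟨d', p'⟩ h' heq
    have hd := (mem_product.mp h).1
    have hd' := (mem_product.mp h').1
    have h1 := congrArg overlinedParts heq
    have h2 := congrArg nonOverlinedParts heq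
    rw [overlinedParts_ofParts hd, overlinedParts_ofParts hd'] at h1
    rw [nonOverlinedParts_ofParts hd, nonOverlinedParts_ofParts hd'] at h2
    exact Prod.ext (Nat.Partition.ext h1) (Nat.Partition.ext h2)
  · intro o ho
    obtain ⟨d, hd, p, rfl⟩ := exists_ofParts_eq o (mem_filter.mp ho).2
    exact ⟨(d, p), mem_product.mpr ⟨hd, mem_univ p⟩, rfl⟩

lemma sum_eq_sum_antidiagonal {M : Type*} [AddCommMonoid M] (g : ℕ × ℕ → M) (n : ℕ) :
    ∑ o : Overpartition n, g (o.overlinedParts.sum, o.nonOverlinedParts.sum) =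
      ∑ x ∈ antidiagonal n,
        (#(Nat.Partition.distincts x.1) * Fintype.card x.2.Partition) • g x := by
  have hmaps (o : Overpartition n) (_ : o ∈ univ) :
      (o.overlinedParts.sum, o.nonOverlinedParts.sum) ∈ antidiagonal n :=
    HasAntidiagonal.mem_antidiagonal.mpr o.sum_overlinedParts_add_sum_nonOverlinedParts
  rw [← sum_fiberwise_of_maps_to hmaps]
  refine sum_congr rfl fun ⟨a, b⟩ hx => ?_
  obtain rfl : a + b = n := HasAntidiagonal.mem_antidiagonal.mp hx
  have hfiber : #{o : Overpartition (a + b) |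
        (o.overlinedParts.sum, o.nonOverlinedParts.sum) = (a, b)} =
      #{o : Overpartition (a + b) | o.overlinedParts.sum = a} := by
    refine congrArg card (filter_congr fun o _ => ?_)
    have := o.sum_overlinedParts_add_sum_nonOverlinedParts
    rw [Prod.mk.injEq]
    omega
  rw [sum_congr rfl fun o ho => congrArg g (mem_filter.mp ho).2, sum_const, hfiber,
    card_filter_sum_overlinedParts]

end Overpartition

section GeneratingFunctions

/-- The generating function of partitions, with coefficients in `R`. -/
def partitionSeries (R : Type*) [Semiring R] : R⟦X⟧ :=
  mk fun n => (Fintype.card n.Partition : R)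

/-- The generating function of partitions into distinct parts, with coefficients in `R`. -/
def distinctSeries (R : Type*) [Semiring R] : R⟦X⟧ :=
  mk fun n => (#(Nat.Partition.distincts n) : R)

/-- The generating function of overpartitions, with coefficients in `R`: the overlined parts form a
partition into distinct parts and the non-overlined parts an arbitrary partition. -/
noncomputable def overpartitionSeries (R : Type*) [Semiring R] : R⟦X⟧ :=
  distinctSeries R * partitionSeries R

variable (R : Type*) [CommRing R]

lemma mk_ov : (mk fun n => (ov n : R)) = euler R (distinctSeries R) * partitionSeries R := by
  ext n
  have h := Overpartition.sum_eq_sum_antidiagonal (fun x => (x.1 : R)) n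
  simp only [coeff_mul, coeff_euler, distinctSeries, partitionSeries, coeff_mk, ov, Nat.cast_sum]
  rw [h]
  refine sum_congr rfl fun x _ => ?_
  rw [nsmul_eq_mul, Nat.cast_mul]
  ring

lemma mk_nov : (mk fun n => (nov n : R)) = distinctSeries R * euler R (partitionSeries R) := by
  ext n
  have h := Overpartition.sum_eq_sum_antidiagonal (fun x => (x.2 : R)) n
  simp only [coeff_mul, coeff_euler, distinctSeries, partitionSeries, coeff_mk, nov, Nat.cast_sum]
  rw [h]
  refine sum_congr rfl fun x _ => ?_
  rw [nsmul_eq_mul, Nat.cast_mul]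
  ring

lemma mk_nov_add_mk_ov : (mk fun n => (nov n : R)) + (mk fun n => (ov n : R)) =
    euler R (overpartitionSeries R) := by
  rw [mk_nov, mk_ov, overpartitionSeries, Derivation.leibniz, smul_eq_mul, smul_eq_mul,
    mul_comm (partitionSeries R)]

end GeneratingFunctions

section FiniteGauss

variable {R : Type*} [CommRing R] (x : R)

lemma finite_gauss_term_sub {n s : ℕ} (hs : s < n) :
    (-1) ^ (s + 1) * x ^ ((s + 1) * (n + 2)) * (∏ k ∈ range s, (1 + x ^ (k + 1))) *
        (∏ k ∈ Ico (s + 1) (n + 1), (1 - x ^ (k + 1))) -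
      (1 + x ^ (n + 1)) * ((-1) ^ (s + 1) * x ^ ((s + 1) * (n + 1)) *
        (∏ k ∈ range s, (1 + x ^ (k + 1))) * ∏ k ∈ Ico (s + 1) n, (1 - x ^ (k + 1))) =
    (-1) ^ s * (x ^ (n + 1)) ^ (s + 1) * (∏ k ∈ range s, (1 + x ^ (k + 1))) *
        (∏ k ∈ Ico s n, (1 - x ^ (k + 1))) -
      (-1) ^ (s + 1) * (x ^ (n + 1)) ^ (s + 2) * (∏ k ∈ range (s + 1), (1 + x ^ (k + 1))) *
        ∏ k ∈ Ico (s + 1) n, (1 - x ^ (k + 1)) := by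
  rw [prod_Ico_succ_top hs, prod_eq_prod_Ico_succ_bot hs, prod_range_succ]
  ring

/-- Gauss's identity `∑ (-1) ^ j x ^ (j ^ 2) = ∏ (1 - x ^ k) / (1 + x ^ k)`, truncated: the sum on
the left is the remainder, divisible by `x ^ (n + 1)`. -/
lemma finite_gauss (n : ℕ) :
    (∏ k ∈ range n, (1 - x ^ (k + 1))) + 2 * ∑ s ∈ range n,
        (-1) ^ (s + 1) * x ^ ((s + 1) * (n + 1)) * (∏ k ∈ range s, (1 + x ^ (k + 1))) *
          ∏ k ∈ Ico (s + 1) n, (1 - x ^ (k + 1)) =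
      (∏ k ∈ range n, (1 + x ^ (k + 1))) *
        (1 + 2 * ∑ s ∈ range n, (-1) ^ (s + 1) * x ^ ((s + 1) ^ 2)) := by
  induction n with
  | zero => simp
  | succ n ih =>
    have htelescope := sum_congr (rfl : range n = range n) fun s hs =>
      finite_gauss_term_sub x (mem_range.mp hs)
    rw [sum_sub_distrib, ← mul_sum, sum_range_sub' fun s =>
      (-1) ^ s * (x ^ (n + 1)) ^ (s + 1) * (∏ k ∈ range s, (1 + x ^ (k + 1))) *
        ∏ k ∈ Ico s n, (1 - x ^ (k + 1)), ← range_eq_Ico] at htelescope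
    simp only [Ico_self, prod_empty, prod_range_zero] at htelescope
    rw [sum_range_succ, sum_range_succ, prod_range_succ, prod_range_succ, Ico_self, prod_empty]
    linear_combination (1 + x ^ (n + 1)) * ih + 2 * htelescope

end FiniteGauss

section ThetaSeries

variable {R : Type*} [CommRing R]

/-- The finite set of integers whose square is `n`. -/
noncomputable def squareRoots (n : ℕ) : Finset ℤ := {j ∈ Icc (-(n : ℤ)) n | j ^ 2 = n}

lemma mem_Icc_of_sq_le {j : ℤ} {n : ℕ} (h : j ^ 2 ≤ n) : j ∈ Icc (-(n : ℤ)) n :=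
  mem_Icc.mpr (abs_le.mp (by
    rw [Int.abs_eq_natAbs]
    exact (Int.natAbs_le_self_sq j).trans h))

lemma mem_squareRoots {j : ℤ} {n : ℕ} : j ∈ squareRoots n ↔ j ^ 2 = n := by
  rw [squareRoots, mem_filter, and_iff_right_iff_imp]
  exact fun h => mem_Icc_of_sq_le h.le

/-- The finite set of lattice points on the circle of squared radius `n`. -/
noncomputable def circlePoints (n : ℕ) : Finset (ℤ × ℤ) :=
  {p ∈ Icc (-(n : ℤ)) n ×ˢ Icc (-(n : ℤ)) n | p.1 ^ 2 + p.2 ^ 2 = n}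

lemma mem_circlePoints {p : ℤ × ℤ} {n : ℕ} : p ∈ circlePoints n ↔ p.1 ^ 2 + p.2 ^ 2 = n := by
  rw [circlePoints, mem_filter, mem_product, and_iff_right_iff_imp]
  exact fun h => ⟨mem_Icc_of_sq_le (by linarith [sq_nonneg p.2]),
    mem_Icc_of_sq_le (by linarith [sq_nonneg p.1])⟩

/-- The theta series `∑ s j X ^ (j ^ 2)`, the sum being over all integers `j`. -/
noncomputable def thetaSeries (s : ℤ → R) : R⟦X⟧ := mk fun n => ∑ j ∈ squareRoots n, s j

lemma coeff_thetaSeries (s : ℤ → R) (n : ℕ) :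
    coeff n (thetaSeries s) = ∑ j ∈ squareRoots n, s j :=
  coeff_mk _ _

lemma constantCoeff_thetaSeries (s : ℤ → R) : constantCoeff (thetaSeries s) = s 0 := by
  rw [← coeff_zero_eq_constantCoeff_apply, coeff_thetaSeries,
    show squareRoots 0 = {0} by decide, sum_singleton]

lemma coeff_one_thetaSeries (s : ℤ → R) : coeff 1 (thetaSeries s) = s (-1) + s 1 := by
  rw [coeff_thetaSeries, show squareRoots 1 = {-1, 1} by decide, sum_pair (by decide)]

lemma coeff_thetaSeries_of_even {s : ℤ → R} (hs : s.Even) {m n : ℕ} (hmn : m ≤ n) :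
    coeff m (thetaSeries s) =
      coeff m (C (s 0) + 2 * ∑ k ∈ range n, C (s ↑(k + 1)) * X ^ ((k + 1) ^ 2)) := by
  have hroots : squareRoots m = {j ∈ Icc (-(n : ℤ)) n | j ^ 2 = (m : ℤ)} := by
    ext j
    rw [mem_squareRoots, mem_filter, iff_and_self]
    exact fun h => mem_Icc_of_sq_le (h.le.trans (by exact_mod_cast hmn))
  have heven : (fun j : ℤ => if j ^ 2 = m then s j else 0).Even := fun j => by
    simp only [neg_sq, hs j]
  rw [coeff_thetaSeries, hroots, sum_filter, sum_Icc_of_even_eq_range heven, sum_range_succ',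
    two_mul, two_nsmul]
  simp only [map_add, map_sum, coeff_C, coeff_C_mul, coeff_X_pow, mul_ite, mul_one, mul_zero]
  norm_cast
  simp only [eq_comm (b := m), zero_pow two_ne_zero]
  ring

lemma coeff_thetaSeries_mul (s t : ℤ → R) (n : ℕ) :
    coeff n (thetaSeries s * thetaSeries t) = ∑ p ∈ circlePoints n, s p.1 * t p.2 := by
  have hmaps (p : ℤ × ℤ) (hp : p ∈ circlePoints n) :
      ((p.1 ^ 2).toNat, (p.2 ^ 2).toNat) ∈ antidiagonal n := by
    rw [mem_circlePoints] at hp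
    rw [HasAntidiagonal.mem_antidiagonal, ← Int.toNat_add (sq_nonneg _) (sq_nonneg _), hp,
      Int.toNat_natCast]
  rw [coeff_mul, ← sum_fiberwise_of_maps_to hmaps]
  refine sum_congr rfl fun ⟨a, b⟩ hab => ?_
  rw [coeff_thetaSeries, coeff_thetaSeries, sum_mul_sum, ← sum_product']
  refine sum_congr ?_ fun _ _ => rfl
  ext p
  rw [HasAntidiagonal.mem_antidiagonal] at hab
  simp only [mem_product, mem_squareRoots, mem_filter, mem_circlePoints, Prod.mk.injEq]
  have h1 := sq_nonneg p.1
  have h2 := sq_nonneg p.2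
  omega

lemma even_add_iff_of_mem_circlePoints {p : ℤ × ℤ} {n : ℕ} (hp : p ∈ circlePoints n) :
    Even (p.1 + p.2) ↔ Even n := by
  rw [← Int.even_coe_nat, ← mem_circlePoints.mp hp, Int.even_add, Int.even_add,
    Int.even_pow' two_ne_zero, Int.even_pow' two_ne_zero]

/-- The rotation `(x, y) ↦ (x + y, x - y)` maps the circle of squared radius `n` onto that of
squared radius `2 * n`, on which `x + y` is always even. -/
lemma sum_circlePoints_two_mul {M : Type*} [AddCommMonoid M] (n : ℕ) (F : ℤ × ℤ → M) :
    ∑ p ∈ circlePoints (2 * n), F p = ∑ p ∈ circlePoints n, F (p.1 + p.2, p.1 - p.2) := by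
  symm
  refine sum_nbij (fun p => (p.1 + p.2, p.1 - p.2)) ?_ ?_ ?_ fun _ _ => rfl
  · intro p hp
    rw [mem_circlePoints] at hp ⊢
    push_cast
    linear_combination 2 * hp
  · rintro ⟨a, b⟩ _ ⟨c, d⟩ _ h
    rw [Prod.mk.injEq] at h ⊢
    omega
  · rintro ⟨a, b⟩ hp
    obtain ⟨c, hc⟩ := (even_add_iff_of_mem_circlePoints hp).mpr (even_two_mul n)
    obtain rfl : a = c + c - b := eq_sub_of_add_eq hc
    rw [mem_coe, mem_circlePoints] at hp
    push_cast at hp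
    refine ⟨(c, c - b), mem_circlePoints.mpr (by linarith), Prod.ext ?_ ?_⟩ <;> dsimp only <;> ring

/-- Jacobi's theta function `θ₃`, as a power series in the nome. -/
noncomputable def theta₃ (R : Type*) [CommRing R] : R⟦X⟧ := thetaSeries fun _ => 1

/-- Jacobi's theta function `θ₄`, as a power series in the nome. -/
noncomputable def theta₄ (R : Type*) [CommRing R] : R⟦X⟧ :=
  thetaSeries fun j => ((j.negOnePow : ℤ) : R)

lemma constantCoeff_theta₃ : constantCoeff (theta₃ R) = 1 := constantCoeff_thetaSeries _

lemma constantCoeff_theta₄ : constantCoeff (theta₄ R) = 1 := by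
  simp [theta₄, constantCoeff_thetaSeries]

lemma coeff_one_theta₃ : coeff 1 (theta₃ R) = 2 := by
  rw [theta₃, coeff_one_thetaSeries, one_add_one_eq_two]

lemma coeff_one_theta₄ : coeff 1 (theta₄ R) = -2 := by
  rw [theta₄, coeff_one_thetaSeries, Int.negOnePow_neg, Int.negOnePow_one]
  norm_num

lemma two_mul_expand_theta₃_sq :
    2 * expand 2 two_ne_zero (theta₃ R) ^ 2 = theta₃ R ^ 2 + theta₄ R ^ 2 := by
  rw [← map_pow, theta₃, theta₄, sq, sq (thetaSeries _), two_mul]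
  ext n
  simp only [map_add, coeff_thetaSeries_mul, ← Int.cast_mul, ← Units.val_mul,
    ← Int.negOnePow_add, ← sum_add_distrib]
  rcases n.even_or_odd' with ⟨m, rfl | rfl⟩
  · rw [coeff_expand_mul, coeff_thetaSeries_mul, sum_circlePoints_two_mul, ← sum_add_distrib]
    refine sum_congr rfl fun p _ => ?_
    rw [Int.negOnePow_even _ ⟨p.1, by ring⟩]
    simp
  · rw [coeff_expand_of_not_dvd _ _ _ (by omega), add_zero]
    refine (sum_eq_zero fun p hp => ?_).symm
    rw [Int.negOnePow_odd]
    · simp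
    · rw [← Int.not_even_iff_odd, even_add_iff_of_mem_circlePoints hp]
      simp

lemma expand_theta₄_sq :
    expand 2 two_ne_zero (theta₄ R) ^ 2 = theta₃ R * theta₄ R := by
  rw [← map_pow, theta₃, theta₄, sq]
  ext n
  rw [coeff_thetaSeries_mul]
  rcases n.even_or_odd' with ⟨m, rfl | rfl⟩
  · rw [coeff_expand_mul, coeff_thetaSeries_mul, sum_circlePoints_two_mul]
    refine sum_congr rfl fun p _ => ?_
    rw [Int.negOnePow_sub, one_mul, Units.val_mul, Int.cast_mul]
  · rw [coeff_expand_of_not_dvd _ _ _ (by omega)]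
    refine (sum_involution (fun p _ => p.swap) (fun p hp => ?_) (fun p hp _ h => ?_)
      (fun p hp => ?_) fun p _ => p.swap_swap).symm
    · have hodd : Odd (p.1 + p.2) := by
        rw [← Int.not_even_iff_odd, even_add_iff_of_mem_circlePoints hp]
        simp
      rw [Prod.snd_swap, eq_sub_of_add_eq (rfl : p.1 + p.2 = _), Int.negOnePow_sub,
        Int.negOnePow_odd _ hodd]
      simp
    · have hp' := even_add_iff_of_mem_circlePoints hp
      obtain h' : p.2 = p.1 := congrArg Prod.fst h
      rw [h'] at hp'
      simp at hp'
    · rw [mem_circlePoints, Prod.fst_swap, Prod.snd_swap, add_comm, mem_circlePoints.mp hp]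

end ThetaSeries

section InfiniteProducts

open scoped PowerSeries.WithPiTopology
open PowerSeries.WithPiTopology Filter Topology

variable {R : Type*} [CommRing R] [TopologicalSpace R]

lemma tendsto_of_forall_coeff_eq {u : ℕ → R⟦X⟧} {f : R⟦X⟧}
    (h : ∀ m n, m ≤ n → coeff m (u n) = coeff m f) : Tendsto u atTop (𝓝 f) :=
  (tendsto_iff_coeff_tendsto R u atTop f).mpr fun m =>
    tendsto_atTop_of_eventually_const (i₀ := m) fun n hn => h m n hn

lemma continuous_expand {p : ℕ} (hp : p ≠ 0) : Continuous (expand (R := R) p hp) := by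
  refine continuous_iff_continuousAt.mpr fun f =>
    (tendsto_iff_coeff_tendsto _ _ _ _).mpr fun n => ?_
  simp only [coeff_expand]
  split_ifs
  · exact (continuous_coeff R _).continuousAt
  · exact tendsto_const_nhds

variable [T2Space R]

lemma hasProd_distinctSeries : HasProd (fun i : ℕ => 1 + X ^ (i + 1)) (distinctSeries R) := by
  have h := Nat.Partition.hasProd_powerSeriesMk_card_countRestricted R Nat.two_pos
  simp only [Nat.Partition.countRestricted_two, sum_range_succ, sum_range_zero, mul_zero,
    pow_zero, mul_one, zero_add] at h
  exact h

variable [IsTopologicalRing R]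

lemma hasProd_partitionSeries :
    HasProd (fun i : ℕ => ∑' j : ℕ, (X ^ (i + 1)) ^ j) (partitionSeries R) := by
  have h := Nat.Partition.hasProd_powerSeriesMk_card_restricted R fun _ => True
  simpa only [if_true, pow_mul, Nat.Partition.restricted, filter_true, implies_true, card_univ]
    using! h

lemma tprod_one_sub_mul_partitionSeries :
    (∏' i : ℕ, (1 - X ^ (i + 1))) * partitionSeries R = 1 := by
  have h := (multipliable_one_sub_X_pow R).hasProd.mul hasProd_partitionSeries
  refine h.unique (hasProd_one.congr_fun fun i => ?_)
  have h0 : constantCoeff (X ^ (i + 1) : R⟦X⟧) = 0 := by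
    rw [map_pow, constantCoeff_X, zero_pow i.succ_ne_zero]
  exact one_sub_mul_tsum_pow_of_constantCoeff_eq_zero h0

lemma tprod_one_sub_mul_distinctSeries :
    (∏' i : ℕ, (1 - X ^ (i + 1))) * distinctSeries R =
      expand 2 two_ne_zero (∏' i : ℕ, (1 - X ^ (i + 1))) := by
  have hE := (multipliable_one_sub_X_pow R).hasProd
  have h := hE.map (expand 2 two_ne_zero) (continuous_expand _)
  refine (hE.mul hasProd_distinctSeries).unique (h.congr_fun fun i => ?_)
  simp only [Function.comp_apply, map_sub, map_one, map_pow, expand_X]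
  ring

lemma theta₄_mul_distinctSeries :
    theta₄ R * distinctSeries R = ∏' i : ℕ, (1 - X ^ (i + 1)) := by
  have htheta : Tendsto (fun n => 1 + 2 * ∑ s ∈ range n, (-1) ^ (s + 1) * X ^ ((s + 1) ^ 2))
      atTop (𝓝 (theta₄ R)) := by
    have hsign (k : ℕ) : (((k : ℤ).negOnePow : ℤ) : R) = (-1) ^ k := by simp [Int.negOnePow_def]
    refine tendsto_of_forall_coeff_eq fun m n hmn => ?_
    rw [theta₄, coeff_thetaSeries_of_even (fun j => by rw [Int.negOnePow_neg]) hmn]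
    simp only [hsign, Int.negOnePow_zero, Units.val_one, Int.cast_one, map_one, map_pow, map_neg]
  have hremainder : Tendsto (fun n => 2 * ∑ s ∈ range n, (-1 : R⟦X⟧) ^ (s + 1) *
      X ^ ((s + 1) * (n + 1)) * (∏ k ∈ range s, (1 + X ^ (k + 1))) *
        ∏ k ∈ Ico (s + 1) n, (1 - X ^ (k + 1))) atTop (𝓝 0) := by
    refine tendsto_of_forall_coeff_eq fun m n hmn => ?_
    rw [map_zero]
    refine X_pow_dvd_iff.mp (dvd_mul_of_dvd_right (dvd_sum fun s _ => ?_) _) m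
      (Nat.lt_succ_of_le hmn)
    have hdvd : (X : R⟦X⟧) ^ (n + 1) ∣ X ^ ((s + 1) * (n + 1)) :=
      pow_dvd_pow _ (Nat.le_mul_of_pos_left _ s.succ_pos)
    exact dvd_mul_of_dvd_left (dvd_mul_of_dvd_left (dvd_mul_of_dvd_right hdvd _) _) _
  have hleft := (multipliable_one_sub_X_pow R).hasProd.tendsto_prod_nat.add hremainder
  simp only [finite_gauss, add_zero] at hleft
  rw [mul_comm]
  exact tendsto_nhds_unique (hasProd_distinctSeries.tendsto_prod_nat.mul htheta) hleft

end InfiniteProducts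

section ProductIdentities

variable (R : Type*) [CommRing R]

lemma theta₄_mul_overpartitionSeries : theta₄ R * overpartitionSeries R = 1 := by
  let _ : TopologicalSpace R := ⊥
  have _ : DiscreteTopology R := ⟨rfl⟩
  rw [overpartitionSeries, ← mul_assoc, theta₄_mul_distinctSeries,
    tprod_one_sub_mul_partitionSeries]

lemma partitionSeries_eq_distinctSeries_mul_expand :
    partitionSeries R = distinctSeries R * expand 2 two_ne_zero (partitionSeries R) := by
  let _ : TopologicalSpace R := ⊥
  have _ : DiscreteTopology R := ⟨rfl⟩
  have hP := tprod_one_sub_mul_partitionSeries (R := R)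
  have hP2 := congrArg (expand 2 two_ne_zero) hP
  rw [map_mul, ← tprod_one_sub_mul_distinctSeries, map_one] at hP2
  linear_combination distinctSeries R * expand 2 two_ne_zero (partitionSeries R) * hP -
    partitionSeries R * hP2

end ProductIdentities

section LogarithmicDerivative

variable {K : Type*} [Field K]

/-- The logarithmic derivative with respect to the Euler operator, for power series with nonzero
constant coefficient. -/
noncomputable def eulerLog (f : K⟦X⟧) : K⟦X⟧ := f⁻¹ * euler K f

lemma constantCoeff_eulerLog (f : K⟦X⟧) : constantCoeff (eulerLog f) = 0 := by
  rw [eulerLog, map_mul, constantCoeff_euler, mul_zero]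

variable {f g : K⟦X⟧}

lemma mul_eulerLog (hf : constantCoeff f ≠ 0) : f * eulerLog f = euler K f := by
  rw [eulerLog, ← mul_assoc, PowerSeries.mul_inv_cancel f hf, one_mul]

lemma eulerLog_one : eulerLog (1 : K⟦X⟧) = 0 := by
  rw [eulerLog, Derivation.map_one_eq_zero, mul_zero]

lemma coeff_one_eulerLog (hf : constantCoeff f = 1) : coeff 1 (eulerLog f) = coeff 1 f := by
  have h := congrArg (coeff 1) (mul_eulerLog (hf.trans_ne one_ne_zero))
  rwa [coeff_euler, coeff_one_mul, constantCoeff_eulerLog, hf, mul_zero, zero_add, mul_one,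
    Nat.cast_one, one_mul] at h

lemma eulerLog_mul (hf : constantCoeff f ≠ 0) (hg : constantCoeff g ≠ 0) :
    eulerLog (f * g) = eulerLog f + eulerLog g := by
  have hfg : constantCoeff (f * g) ≠ 0 := by rw [map_mul]; exact mul_ne_zero hf hg
  refine mul_left_cancel₀ (ne_zero_of_map hfg) ?_
  rw [mul_eulerLog hfg, Derivation.leibniz, smul_eq_mul, smul_eq_mul, ← mul_eulerLog hf,
    ← mul_eulerLog hg]
  ring

lemma eulerLog_expand {p : ℕ} (hp : p ≠ 0) (hf : constantCoeff f ≠ 0) :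
    eulerLog (expand p hp f) = p * expand p hp (eulerLog f) := by
  have hpf : constantCoeff (expand p hp f) ≠ 0 := by rwa [constantCoeff_expand]
  refine mul_left_cancel₀ (ne_zero_of_map hpf) ?_
  rw [mul_eulerLog hpf, euler_expand, ← mul_eulerLog hf, map_mul]
  ring

end LogarithmicDerivative

section ThetaLogarithmicDerivatives

variable (K : Type*) [Field K]

local notation "V" => expand 2 two_ne_zero
local notation "θ₃" => theta₃ K
local notation "θ₄" => theta₄ K

lemma constantCoeff_theta₃_ne_zero : constantCoeff θ₃ ≠ 0 :=
  constantCoeff_theta₃.trans_ne one_ne_zero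

lemma constantCoeff_theta₄_ne_zero : constantCoeff θ₄ ≠ 0 :=
  constantCoeff_theta₄.trans_ne one_ne_zero

lemma euler_theta₃ : euler K θ₃ = θ₃ * eulerLog θ₃ :=
  (mul_eulerLog (constantCoeff_theta₃_ne_zero K)).symm

lemma euler_theta₄ : euler K θ₄ = θ₄ * eulerLog θ₄ :=
  (mul_eulerLog (constantCoeff_theta₄_ne_zero K)).symm

lemma four_mul_expand_eulerLog_theta₄ : 4 * V (eulerLog θ₄) = eulerLog θ₃ + eulerLog θ₄ := by
  have h₃ := constantCoeff_theta₃_ne_zero K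
  have h₄ := constantCoeff_theta₄_ne_zero K
  have hV : constantCoeff (V θ₄) ≠ 0 := by rwa [constantCoeff_expand]
  rw [← eulerLog_mul h₃ h₄, ← expand_theta₄_sq, sq, eulerLog_mul hV hV,
    eulerLog_expand two_ne_zero h₄, Nat.cast_ofNat]
  ring

lemma four_mul_expand_eulerLog_theta₃ :
    4 * (θ₃ ^ 2 + θ₄ ^ 2) * V (eulerLog θ₃) =
      2 * (θ₃ ^ 2 * eulerLog θ₃ + θ₄ ^ 2 * eulerLog θ₄) := by
  have h := two_mul_expand_theta₃_sq (R := K)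
  have hD := congrArg (euler K) h
  simp only [euler_ofNat_mul, Derivation.leibniz_pow, euler_expand, map_add, euler_theta₃,
    euler_theta₄, map_mul, smul_eq_mul, nsmul_eq_mul] at hD
  push_cast at hD
  linear_combination hD - 4 * V (eulerLog θ₃) * h

lemma four_mul_expand_theta₃_pow_four : 4 * V θ₃ ^ 4 = (θ₃ ^ 2 + θ₄ ^ 2) ^ 2 := by
  rw [← two_mul_expand_theta₃_sq]
  ring

lemma expand_theta₄_pow_four : V θ₄ ^ 4 = θ₃ ^ 2 * θ₄ ^ 2 := by
  rw [← mul_pow, ← expand_theta₄_sq, ← pow_mul]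

/-- `θ₂⁴ + θ₃⁴`, a modular form of weight two, with `θ₂⁴` written as `θ₃⁴ - θ₄⁴`. -/
noncomputable def thetaWeightTwo : K⟦X⟧ := 2 * θ₃ ^ 4 - θ₄ ^ 4

/-- `θ₂⁴ θ₃⁴`, a modular form of weight four, with `θ₂⁴` written as `θ₃⁴ - θ₄⁴`. -/
noncomputable def thetaWeightFour : K⟦X⟧ := θ₃ ^ 4 * (θ₃ ^ 4 - θ₄ ^ 4)

local notation "E" => thetaWeightTwo K
local notation "U" => thetaWeightFour K

lemma euler_theta₄_pow_four : euler K (θ₄ ^ 4) = 4 * eulerLog θ₄ * θ₄ ^ 4 := by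
  rw [Derivation.leibniz_pow, euler_theta₄, smul_eq_mul, nsmul_eq_mul]
  push_cast
  ring

lemma two_mul_expand_thetaWeightTwo : 2 * V E = θ₃ ^ 4 + θ₄ ^ 4 := by
  rw [thetaWeightTwo, map_sub, map_mul, map_pow, map_pow, map_ofNat]
  linear_combination four_mul_expand_theta₃_pow_four K - 2 * expand_theta₄_pow_four K

lemma sixteen_mul_expand_thetaWeightFour : 16 * V U = (θ₃ ^ 4 - θ₄ ^ 4) ^ 2 := by
  have h₃ := four_mul_expand_theta₃_pow_four K
  have h₄ := expand_theta₄_pow_four K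
  rw [thetaWeightFour, map_mul, map_sub, map_pow, map_pow]
  linear_combination (4 * V θ₃ ^ 4 + (θ₃ ^ 2 - θ₄ ^ 2) ^ 2) * h₃ - 16 * V θ₃ ^ 4 * h₄

variable [NeZero (2 : K)]

/-- Jacobi's formula for the logarithmic derivative of `θ₃ / θ₄`. -/
theorem four_mul_eulerLog_theta₃_sub_eulerLog_theta₄ :
    4 * (eulerLog θ₃ - eulerLog θ₄) = θ₃ ^ 4 - θ₄ ^ 4 := by
  rw [← sub_eq_zero]
  have h8 : (8 : K) ≠ 0 := by
    rw [show (8 : K) = 2 ^ 3 by norm_num]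
    exact pow_ne_zero 3 two_ne_zero
  have hb : coeff 1 (θ₃ ^ 2 - θ₄ ^ 2) = 8 := by
    rw [map_sub, coeff_one_pow, coeff_one_pow, constantCoeff_theta₃, constantCoeff_theta₄,
      coeff_one_theta₃, coeff_one_theta₄]
    norm_num
  refine eq_zero_of_mul_expand_two_eq_mul (a := 4 * (θ₃ ^ 2 + θ₄ ^ 2)) (b := θ₃ ^ 2 - θ₄ ^ 2)
    (hb.trans_ne h8) ?_ ?_ ?_
  · simp [constantCoeff_theta₃, constantCoeff_theta₄, constantCoeff_eulerLog]
  · rw [map_sub, ← map_ofNat (C (R := K)), coeff_C_mul, map_sub, map_sub, coeff_one_pow,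
      coeff_one_pow, coeff_one_eulerLog constantCoeff_theta₃,
      coeff_one_eulerLog constantCoeff_theta₄, constantCoeff_theta₃, constantCoeff_theta₄,
      coeff_one_theta₃, coeff_one_theta₄]
    norm_num
  · simp only [map_sub, map_mul, map_pow, map_ofNat]
    linear_combination 4 * four_mul_expand_eulerLog_theta₃ K -
      4 * (θ₃ ^ 2 + θ₄ ^ 2) * four_mul_expand_eulerLog_theta₄ K -
      (θ₃ ^ 2 + θ₄ ^ 2) * four_mul_expand_theta₃_pow_four K +
      4 * (θ₃ ^ 2 + θ₄ ^ 2) * expand_theta₄_pow_four K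

lemma euler_theta₃_pow_four :
    euler K (θ₃ ^ 4) = (4 * eulerLog θ₄ + (θ₃ ^ 4 - θ₄ ^ 4)) * θ₃ ^ 4 := by
  rw [Derivation.leibniz_pow, euler_theta₃, smul_eq_mul, nsmul_eq_mul]
  push_cast
  linear_combination θ₃ ^ 4 * four_mul_eulerLog_theta₃_sub_eulerLog_theta₄ K

lemma euler_thetaWeightTwo : euler K E = 4 * eulerLog θ₄ * E + 2 * U := by
  rw [thetaWeightTwo, thetaWeightFour, map_sub, euler_ofNat_mul, euler_theta₃_pow_four,
    euler_theta₄_pow_four]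
  ring

lemma euler_thetaWeightFour : euler K U = U * (8 * eulerLog θ₄ + E) := by
  rw [thetaWeightTwo, thetaWeightFour, Derivation.leibniz, map_sub, euler_theta₃_pow_four,
    euler_theta₄_pow_four, smul_eq_mul, smul_eq_mul]
  ring

lemma two_ne_zero_powerSeries : (2 : K⟦X⟧) ≠ 0 := by
  rw [← map_ofNat (C (R := K))]
  exact (map_ne_zero_iff _ C_injective).mpr two_ne_zero

theorem eight_mul_euler_eulerLog_theta₄ :
    8 * euler K (eulerLog θ₄) = 16 * eulerLog θ₄ ^ 2 - U := by
  have hJ := four_mul_eulerLog_theta₃_sub_eulerLog_theta₄ K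
  have hV := four_mul_expand_eulerLog_theta₄ K
  have hDJ : 4 * (euler K (eulerLog θ₃) - euler K (eulerLog θ₄)) =
      (4 * eulerLog θ₄ + (θ₃ ^ 4 - θ₄ ^ 4)) * θ₃ ^ 4 - 4 * eulerLog θ₄ * θ₄ ^ 4 := by
    rw [← euler_theta₃_pow_four, ← euler_theta₄_pow_four, ← map_sub, ← map_sub, ← hJ,
      euler_ofNat_mul]
  have hDV : 8 * V (euler K (eulerLog θ₄)) =
      euler K (eulerLog θ₃) + euler K (eulerLog θ₄) := by
    rw [← map_add, ← hV, euler_ofNat_mul, euler_expand]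
    push_cast
    ring
  rw [← sub_eq_zero]
  refine eq_zero_of_eq_C_mul_expand one_lt_two (c := 4) ?_ ?_
  · simp [thetaWeightFour, constantCoeff_theta₃, constantCoeff_theta₄, constantCoeff_euler,
      constantCoeff_eulerLog]
  · have h4 : (4 : K⟦X⟧) ≠ 0 := by
      rw [show (4 : K⟦X⟧) = 2 * 2 by norm_num]
      exact mul_ne_zero (two_ne_zero_powerSeries K) (two_ne_zero_powerSeries K)
    refine mul_left_cancel₀ h4 ?_
    have hU := sixteen_mul_expand_thetaWeightFour K
    simp only [map_sub, map_mul, map_pow, map_ofNat]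
    rw [thetaWeightFour] at hU ⊢
    linear_combination -4 * hDJ - 16 * hDV - hU +
      16 * (4 * V (eulerLog θ₄) + eulerLog θ₄ + eulerLog θ₃) * hV +
      (4 * (eulerLog θ₃ - eulerLog θ₄) + (θ₃ ^ 4 - θ₄ ^ 4) + 16 * eulerLog θ₄) * hJ

end ThetaLogarithmicDerivatives

section OverpartitionSeries

variable (K : Type*) [Field K]

local notation "V" => expand 2 two_ne_zero
local notation "θ₄" => theta₄ K
local notation "E" => thetaWeightTwo K
local notation "P" => overpartitionSeries K

lemma constantCoeff_overpartitionSeries : constantCoeff P = 1 := by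
  have h := congrArg constantCoeff (theta₄_mul_overpartitionSeries K)
  rwa [map_mul, constantCoeff_theta₄, one_mul, map_one] at h

lemma constantCoeff_distinctSeries_ne_zero : constantCoeff (distinctSeries K) ≠ 0 := by
  refine left_ne_zero_of_mul (b := constantCoeff (partitionSeries K)) ?_
  rw [← map_mul, ← overpartitionSeries, constantCoeff_overpartitionSeries]
  exact one_ne_zero

lemma constantCoeff_partitionSeries_ne_zero : constantCoeff (partitionSeries K) ≠ 0 := by
  refine right_ne_zero_of_mul (a := constantCoeff (distinctSeries K)) ?_
  rw [← map_mul, ← overpartitionSeries, constantCoeff_overpartitionSeries]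
  exact one_ne_zero

lemma eulerLog_overpartitionSeries : eulerLog P = -eulerLog θ₄ := by
  rw [eq_neg_iff_add_eq_zero, add_comm, ← eulerLog_mul (constantCoeff_theta₄_ne_zero K),
    theta₄_mul_overpartitionSeries, eulerLog_one]
  rw [constantCoeff_overpartitionSeries]
  exact one_ne_zero

lemma euler_overpartitionSeries : euler K P = -(P * eulerLog θ₄) := by
  rw [← mul_neg, ← eulerLog_overpartitionSeries, mul_eulerLog]
  rw [constantCoeff_overpartitionSeries]
  exact one_ne_zero

lemma two_mul_eulerLog_distinctSeries_sub_expand :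
    2 * (eulerLog (distinctSeries K) - V (eulerLog (distinctSeries K))) =
      2 * V (eulerLog θ₄) - eulerLog θ₄ := by
  have hD := constantCoeff_distinctSeries_ne_zero K
  have hP := constantCoeff_partitionSeries_ne_zero K
  have hDP : eulerLog (distinctSeries K) + eulerLog (partitionSeries K) = -eulerLog θ₄ := by
    rw [← eulerLog_mul hD hP, ← overpartitionSeries, eulerLog_overpartitionSeries]
  have hexp : eulerLog (partitionSeries K) =
      eulerLog (distinctSeries K) + 2 * V (eulerLog (partitionSeries K)) := by
    conv_lhs => rw [partitionSeries_eq_distinctSeries_mul_expand]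
    rw [eulerLog_mul hD (by rwa [constantCoeff_expand]), eulerLog_expand two_ne_zero hP]
    rfl
  have hV := congrArg V hDP
  rw [map_add, map_neg] at hV
  linear_combination hDP - hexp - 2 * hV

variable [NeZero (2 : K)]

/-- The Eisenstein series `1 + 24 ∑ k Xᵏ / (1 + Xᵏ)` in terms of theta functions. -/
theorem one_add_mul_eulerLog_distinctSeries :
    1 + 24 * eulerLog (distinctSeries K) = E := by
  rw [← sub_eq_zero]
  refine eq_zero_of_eq_C_mul_expand one_lt_two (c := 1) ?_ ?_
  · simp only [thetaWeightTwo, map_sub, map_add, map_mul, map_pow, map_one, map_ofNat,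
      constantCoeff_theta₃, constantCoeff_theta₄, constantCoeff_eulerLog]
    norm_num
  · refine mul_left_cancel₀ (two_ne_zero_powerSeries K) ?_
    have hA := two_mul_eulerLog_distinctSeries_sub_expand K
    have hw := four_mul_expand_eulerLog_theta₄ K
    have hJ := four_mul_eulerLog_theta₃_sub_eulerLog_theta₄ K
    have hE := two_mul_expand_thetaWeightTwo K
    simp only [map_add, map_sub, map_mul, map_ofNat, map_one]
    rw [thetaWeightTwo] at hE ⊢
    linear_combination 24 * hA + 12 * hw + 3 * hJ + hE

theorem mul_mk_ov : 24 * (mk fun n => (ov n : K)) = P * E - P := by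
  rw [mk_ov, ← mul_eulerLog (constantCoeff_distinctSeries_ne_zero K), overpartitionSeries]
  linear_combination
    distinctSeries K * partitionSeries K * one_add_mul_eulerLog_distinctSeries K

end OverpartitionSeries

section DifferentialSystem

variable (K : Type*) [Field K]

local notation "D" => euler K
local notation "w" => eulerLog (theta₄ K)
local notation "E" => thetaWeightTwo K
local notation "U" => thetaWeightFour K

lemma euler_theta₄_mul (f : K⟦X⟧) : D (theta₄ K * f) = theta₄ K * (D f + w * f) := by
  rw [Derivation.leibniz, euler_theta₄, smul_eq_mul, smul_eq_mul]
  ring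

lemma euler_overpartitionSeries_mul (f : K⟦X⟧) :
    D (overpartitionSeries K * f) = overpartitionSeries K * (D f - w * f) := by
  rw [Derivation.leibniz, euler_overpartitionSeries, smul_eq_mul, smul_eq_mul]
  ring

variable [NeZero (2 : K)]

lemma eight_mul_iterate_two_euler_theta₄ :
    8 * D^[2] (theta₄ K) = theta₄ K * (24 * w ^ 2 - U) := by
  rw [Function.iterate_succ_apply', Function.iterate_one, euler_theta₄, euler_theta₄_mul]
  linear_combination theta₄ K * eight_mul_euler_eulerLog_theta₄ K

lemma eight_mul_iterate_three_euler_theta₄ :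
    8 * D^[3] (theta₄ K) = theta₄ K * (120 * w ^ 3 - 15 * (w * U) - E * U) := by
  rw [Function.iterate_succ_apply', ← euler_ofNat_mul, eight_mul_iterate_two_euler_theta₄,
    euler_theta₄_mul, map_sub, euler_ofNat_mul, Derivation.leibniz_pow, euler_thetaWeightFour,
    smul_eq_mul, nsmul_eq_mul]
  push_cast
  linear_combination 6 * theta₄ K * w * eight_mul_euler_eulerLog_theta₄ K

lemma sixty_four_mul_iterate_four_euler_theta₄ : 64 * D^[4] (theta₄ K) =
    theta₄ K * (6720 * w ^ 4 - 1680 * w ^ 2 * U - 224 * w * E * U - U ^ 2 - 8 * E ^ 2 * U) := by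
  have h : 8 * D^[4] (theta₄ K) =
      theta₄ K * (D (120 * w ^ 3 - 15 * (w * U) - E * U) +
        w * (120 * w ^ 3 - 15 * (w * U) - E * U)) := by
    rw [Function.iterate_succ_apply', ← euler_ofNat_mul, eight_mul_iterate_three_euler_theta₄,
      euler_theta₄_mul]
  rw [map_sub, map_sub, euler_ofNat_mul, euler_ofNat_mul] at h
  simp only [Derivation.leibniz, Derivation.leibniz_pow, euler_thetaWeightTwo,
    euler_thetaWeightFour, smul_eq_mul, nsmul_eq_mul] at h
  push_cast at h
  linear_combination 8 * h +
    theta₄ K * (360 * w ^ 2 - 15 * U) * eight_mul_euler_eulerLog_theta₄ K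

lemma euler_overpartitionSeries_mul_thetaWeightTwo :
    D (overpartitionSeries K * E) = overpartitionSeries K * (3 * (w * E) + 2 * U) := by
  rw [euler_overpartitionSeries_mul, euler_thetaWeightTwo]
  ring

lemma eight_mul_iterate_two_euler_overpartitionSeries_mul_thetaWeightTwo :
    8 * D^[2] (overpartitionSeries K * E) =
      overpartitionSeries K * (120 * (w ^ 2 * E) + 160 * (w * U) + 13 * (E * U)) := by
  rw [Function.iterate_succ_apply', Function.iterate_one,
    euler_overpartitionSeries_mul_thetaWeightTwo, euler_overpartitionSeries_mul, map_add,
    euler_ofNat_mul, euler_ofNat_mul, Derivation.leibniz, euler_thetaWeightTwo,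
    euler_thetaWeightFour, smul_eq_mul, smul_eq_mul]
  linear_combination 3 * overpartitionSeries K * E * eight_mul_euler_eulerLog_theta₄ K

lemma eight_mul_iterate_three_euler_overpartitionSeries_mul_thetaWeightTwo :
    8 * D^[3] (overpartitionSeries K * E) = overpartitionSeries K *
      (840 * w ^ 3 * E + 1680 * w ^ 2 * U + 273 * w * E * U + 6 * U ^ 2 + 13 * E ^ 2 * U) := by
  have h : 8 * D^[3] (overpartitionSeries K * E) = overpartitionSeries K *
      (D (120 * (w ^ 2 * E) + 160 * (w * U) + 13 * (E * U)) -
        w * (120 * (w ^ 2 * E) + 160 * (w * U) + 13 * (E * U))) := by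
    rw [Function.iterate_succ_apply', ← euler_ofNat_mul,
      eight_mul_iterate_two_euler_overpartitionSeries_mul_thetaWeightTwo,
      euler_overpartitionSeries_mul]
  rw [map_add, map_add, euler_ofNat_mul, euler_ofNat_mul, euler_ofNat_mul] at h
  simp only [Derivation.leibniz, Derivation.leibniz_pow, euler_thetaWeightTwo,
    euler_thetaWeightFour, smul_eq_mul, nsmul_eq_mul] at h
  push_cast at h
  linear_combination h + overpartitionSeries K * (30 * w * E + 20 * U) *
    eight_mul_euler_eulerLog_theta₄ K

end DifferentialSystem

section Congruences

lemma iterate_euler_thetaSeries {p m : ℕ} [Fact p.Prime] (hm : 2 * m = p + 1)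
    (s : ℤ → ZMod p) : (euler (ZMod p))^[m] (thetaSeries s) = euler (ZMod p) (thetaSeries s) := by
  ext n
  rw [coeff_iterate_euler, coeff_euler, coeff_thetaSeries, mul_sum, mul_sum]
  refine sum_congr rfl fun j hj => ?_
  have hn : (n : ZMod p) = (j : ZMod p) ^ 2 := by
    rw [← Int.cast_natCast, ← mem_squareRoots.mp hj, Int.cast_pow]
  rw [hn, ← pow_mul, hm, pow_succ, ZMod.pow_card, sq]

lemma natCast_powerSeries_zmod (p : ℕ) : (p : (ZMod p)⟦X⟧) = 0 := by
  rw [← map_natCast (C (R := ZMod p)), ZMod.natCast_self, map_zero]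

lemma cast_nov_add_cast_ov (R : Type*) [CommRing R] (n : ℕ) :
    (nov n + ov n : R) = n * coeff n (overpartitionSeries R) := by
  simpa only [map_add, coeff_mk, coeff_euler] using congrArg (coeff n) (mk_nov_add_mk_ov R)

lemma mul_cast_ov (K : Type*) [Field K] [NeZero (2 : K)] (n : ℕ) :
    (24 * ov n : K) = coeff n (overpartitionSeries K * thetaWeightTwo K) -
      coeff n (overpartitionSeries K) := by
  simpa only [map_sub, coeff_mk, coeff_ofNat_mul] using congrArg (coeff n) (mul_mk_ov K)

section ModFive

local instance : Fact (Nat.Prime 5) := ⟨Nat.prime_five⟩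

local instance : NeZero (2 : ZMod 5) := ⟨by decide⟩

local notation "D" => euler (ZMod 5)
local notation "P" => overpartitionSeries (ZMod 5)
local notation "w" => eulerLog (theta₄ (ZMod 5))
local notation "E" => thetaWeightTwo (ZMod 5)
local notation "U" => thetaWeightFour (ZMod 5)

lemma eulerLog_theta₄_zmod_five : w = 3 * E * U := by
  have h5 : (5 : (ZMod 5)⟦X⟧) = 0 := natCast_powerSeries_zmod 5
  have hcube : 8 * w = 120 * w ^ 3 - 15 * (w * U) - E * U := by
    refine mul_left_cancel₀ (ne_zero_of_map (constantCoeff_theta₄_ne_zero (ZMod 5))) ?_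
    rw [← eight_mul_iterate_three_euler_theta₄, theta₄, iterate_euler_thetaSeries rfl, ← theta₄,
      euler_theta₄, mul_left_comm]
  linear_combination 2 * hcube + (48 * w ^ 3 - 6 * w * U - E * U - 3 * w) * h5

lemma iterate_two_euler_overpartitionSeries_mul_zmod_five : D^[2] (P * E) = -2 * D P := by
  have h5 : (5 : (ZMod 5)⟦X⟧) = 0 := natCast_powerSeries_zmod 5
  linear_combination
    2 * eight_mul_iterate_two_euler_overpartitionSeries_mul_thetaWeightTwo (ZMod 5) -
    2 * P * eulerLog_theta₄_zmod_five + 2 * euler_overpartitionSeries (ZMod 5) +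
    (P * (48 * w ^ 2 * E + 64 * w * U + 4 * E * U) - 3 * D^[2] (P * E)) * h5

theorem nov_ov_modEq_five (n : ℕ) : ((n : ℤ) + 2) * (nov n : ℤ) ≡
    ((n : ℤ) ^ 2 + 4 * (n : ℤ) + 3) * (ov n : ℤ) [ZMOD 5] := by
  have h5 : (5 : ZMod 5) = 0 := ZMod.natCast_self 5
  have hsum := cast_nov_add_cast_ov (ZMod 5) n
  have hov := mul_cast_ov (ZMod 5) n
  have h := congrArg (coeff n) iterate_two_euler_overpartitionSeries_mul_zmod_five
  rw [coeff_iterate_euler, neg_mul, map_neg, coeff_ofNat_mul, coeff_euler] at h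
  refine (ZMod.intCast_eq_intCast_iff _ _ 5).mp ?_
  push_cast
  linear_combination ((n : ZMod 5) + 2) * hsum + h + (n : ZMod 5) ^ 2 * hov -
    (5 * (n : ZMod 5) ^ 2 + n + 1) * ov n * h5

end ModFive

section ModSeven

local instance : Fact (Nat.Prime 7) := ⟨Nat.prime_seven⟩

local instance : NeZero (2 : ZMod 7) := ⟨by decide⟩

local notation "D" => euler (ZMod 7)
local notation "P" => overpartitionSeries (ZMod 7)
local notation "w" => eulerLog (theta₄ (ZMod 7))
local notation "E" => thetaWeightTwo (ZMod 7)
local notation "U" => thetaWeightFour (ZMod 7)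

lemma eulerLog_theta₄_zmod_seven : w = -(U ^ 2 + E ^ 2 * U) := by
  have h7 : (7 : (ZMod 7)⟦X⟧) = 0 := natCast_powerSeries_zmod 7
  have hfourth : 64 * w = 6720 * w ^ 4 - 1680 * w ^ 2 * U - 224 * w * E * U - U ^ 2 -
      8 * E ^ 2 * U := by
    refine mul_left_cancel₀ (ne_zero_of_map (constantCoeff_theta₄_ne_zero (ZMod 7))) ?_
    rw [← sixty_four_mul_iterate_four_euler_theta₄, theta₄, iterate_euler_thetaSeries rfl,
      ← theta₄, euler_theta₄, mul_left_comm]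
  linear_combination hfourth +
    (960 * w ^ 4 - 240 * w ^ 2 * U - 32 * w * E * U - E ^ 2 * U - 9 * w) * h7

lemma iterate_three_euler_overpartitionSeries_mul_zmod_seven : D^[3] (P * E) = -D P := by
  have h7 : (7 : (ZMod 7)⟦X⟧) = 0 := natCast_powerSeries_zmod 7
  linear_combination
    eight_mul_iterate_three_euler_overpartitionSeries_mul_thetaWeightTwo (ZMod 7) -
    P * eulerLog_theta₄_zmod_seven + euler_overpartitionSeries (ZMod 7) +
    (P * (120 * w ^ 3 * E + 240 * w ^ 2 * U + 39 * w * E * U + U ^ 2 + 2 * E ^ 2 * U) -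
      D^[3] (P * E)) * h7

theorem nov_ov_modEq_seven (n : ℕ) : ((n : ℤ) ^ 2 + 1) * (nov n : ℤ) ≡
    (4 * (n : ℤ) ^ 3 - (n : ℤ) ^ 2 - 1) * (ov n : ℤ) [ZMOD 7] := by
  have h7 : (7 : ZMod 7) = 0 := ZMod.natCast_self 7
  have hsum := cast_nov_add_cast_ov (ZMod 7) n
  have hov := mul_cast_ov (ZMod 7) n
  have h := congrArg (coeff n) iterate_three_euler_overpartitionSeries_mul_zmod_seven
  rw [coeff_iterate_euler, map_neg, coeff_euler] at h
  refine (ZMod.intCast_eq_intCast_iff _ _ 7).mp ?_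
  push_cast
  linear_combination ((n : ZMod 7) ^ 2 + 1) * hsum + h + (n : ZMod 7) ^ 3 * hov -
    4 * (n : ZMod 7) ^ 3 * ov n * h7

end ModSeven

end Congruences

theorem theorem1p2 :
    (∀ n : ℕ, ((n : ℤ) + 2) * (nov n : ℤ) ≡
      ((n : ℤ) ^ 2 + 4 * (n : ℤ) + 3) * (ov n : ℤ) [ZMOD 5]) ∧
    (∀ n : ℕ, ((n : ℤ) ^ 2 + 1) * (nov n : ℤ) ≡
      (4 * (n : ℤ) ^ 3 - (n : ℤ) ^ 2 - 1) * (ov n : ℤ) [ZMOD 7]) :=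
  ⟨nov_ov_modEq_five, nov_ov_modEq_seven⟩
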